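/- Consider a polling system in which a single server visits queues $Q_1,\dots,Q_N$ ($N\ge 1$) in cyclic order, each queue being served according to either the gated or the exhaustive discipline. Queue $Q_j$ has $K_j$ priority levels, level $1$ being the highest. Type $j$ customers of level $k$ arrive according to a Poisson process with rate $\lambda_{jk}\ge 0$, where $\lambda_j:=\sum_{k=1}^{K_j}\lambda_{jk}>0$, and have service times distributed as $B_{jk}$ (an arbitrary nonnegative random variable); the switch from $Q_j$ to $Q_{j+1}$ (indices modulo $N$) takes a random time distributed as $S_j\ge 0$. All arrival processes, service times and switch-over times are independent. During a visit to $Q_j$ the server repeatedly takes, among the customers that are to be served in this visit (gated: those present at the visit beginning; exhaustive: all those present in $Q_j$), a customer of the highest priority level represented and serves him without interruption, until no such customer is left. Suppose that $\rho:=\sum_{j=1}^{N}\sum_{k=1}^{K_j}\lambda_{jk}E(B_{jk})<1$. The corresponding system without priorities has the same queues, disciplines and switch-over times, Poisson arrivals at $Q_j$ with rate $\lambda_j$, and service times at $Q_j$ distributed as $B_j$, the mixture of the laws of $B_{j1},\dots,B_{jK_j}$ with weights $\lambda_{j1}/\lambda_j,\dots,\lambda_{jK_j}/\lambda_j$. In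 either system, a steady state at visit beginnings is a family of probability laws $(P_1,\dots,P_N)$ of the joint queue lengths such that, for every $i$, if the joint queue lengths at a visit beginning to $Q_i$ have law $P_i$, then those at the next visit beginning to $Q_{i+1}$ have law $P_{i+1}$ (indices modulo $N$). Suppose that the system without priorities is in steady state at visit beginnings, and let $V_{b_i}(z_1,\dots,z_N)$ be the generating function of the joint queue lengths $(X_{i1},\dots,X_{iN})$ at a visit beginning to $Q_i$. Then the system with priorities has exactly one steady state at visit beginnings, and if $V^{\mathrm{prio}}_{b_i}(z_{11},\dots,z_{1K_1},\dots,z_{N1},\dots,z_{NK_N})=E\big[\prod_{j=1}^N\prod_{k=1}^{K_j}z_{jk}^{X_{ijk}}\big]$ denotes in it the generating function of the numbers $X_{ijk}$ of type $j$ customers of level $k$ present at a visit beginning to $Q_i$, then for all $i=1,\dots,N$ and all complex $z_{jk}$ with $|z_{jk}|\le 1$, $$V^{\mathrm{prio}}_{b_i}(z_{11},\dots,z_{1K_1},\dots,z_{N1},\dots,z_{NK_N}) = V_{b_i}\left(\frac{1}{\lambda_1}\sum_{k=1}^{K_1}\lambda_{1k} z_{1k},\ \dots,\ \frac{1}{\lambda_N}\sum_{k=1}^{K_N}\lambda_{Nk}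 z_{Nk}\right).$$ -/

import Mathlib

open MeasureTheory ProbabilityTheory
open scoped NNReal ENNReal

namespace Polling

/-- The two service disciplines. -/
inductive Discipline
  | gated
  | exhaustive
  deriving DecidableEq

/-- Joint queue lengths: `x j k` is the number of type `j` customers of priority level `k` that are
present. Queue `j` has `K j` levels; level `0` has the highest priority. -/
abbrev State {N : ℕ} (K : Fin N → ℕ) : Type := (j : Fin N) → Fin (K j) → ℕ

/-- The data of a cyclic single-server polling system with `N` queues and `K j` priority levels
in queue `j`. A system without priorities is one with `K j = 1` for all `j`. -/
structure System (N : ℕ) (K : Fin N → ℕ) where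
  /-- the service discipline of each queue -/
  discipline : Fin N → Discipline
  /-- `rate j k` is the intensity of the Poisson arrival process of type `j`, level `k` -/
  rate : (j : Fin N) → Fin (K j) → ℝ≥0
  /-- every queue has a positive total arrival rate -/
  rate_pos : ∀ j, 0 < ∑ k, rate j k
  /-- `service j k` is the law of the service time of a type `j` customer of level `k` -/
  service : (j : Fin N) → Fin (K j) → ProbabilityMeasure ℝ≥0
  /-- `switchover j` is the law of the time the server needs to go from queue `j` to the next -/
  switchover : Fin N → ProbabilityMeasure ℝ≥0

namespace System

variable {N : ℕ} {K : Fin N → ℕ} (M : System N K)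

/-- The total arrival rate `λ_j` at queue `j`. -/
noncomputable def totalRate (j : Fin N) : ℝ≥0 := ∑ k, M.rate j k

/-- The fraction of time `ρ` that the server is working. -/
noncomputable def load : ℝ≥0∞ :=
  ∑ j, ∑ k, (M.rate j k : ℝ≥0∞) * ∫⁻ t : ℝ≥0, (t : ℝ≥0∞) ∂(M.service j k : Measure ℝ≥0)

/-- The probability that the joint numbers of arrivals, during a random time with law `τ` that is
independent of the (independent, Poisson) arrival processes, are equal to `a`. -/
noncomputable def arrivals (τ : ProbabilityMeasure ℝ≥0) (a : State K) : ℝ≥0∞ :=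
  ∫⁻ t : ℝ≥0, ∏ j, ∏ k, poissonMeasure (M.rate j k * t) {a j k} ∂(τ : Measure ℝ≥0)

/-- Removal of one type `i` customer of level `k`. -/
def depart (x : State K) (i : Fin N) (k : Fin (K i)) : State K :=
  Function.update x i (Function.update (x i) k (x i k - 1))

/-- `g` counts, by level, the customers of queue `i` that are still to be served in the current
visit as far as known. This is the same vector after the service of a level `k` customer that left
the joint queue lengths `x'`: under gated service the customers who arrive during the visit do not
count, under exhaustive service everybody present in the queue counts. -/
def entitled (i : Fin N) (g : Fin (K i) → ℕ) (k : Fin (K i)) (x' : State K) : Fin (K i) → ℕ :=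
  match M.discipline i with
  | .gated => Function.update g k (g k - 1)
  | .exhaustive => x' i

/-- The probability that a visit to queue `i`, at an epoch at which no service is in progress, the
joint queue lengths are `x` and the customers still to be served are `g`, ends after exactly `n`
further services and leaves the joint queue lengths `y`. The server always takes a customer of the
highest priority level that is represented in `g`, and serves him without interruption. -/
noncomputable def visitIn (i : Fin N) : ℕ → State K → (Fin (K i) → ℕ) → State K → ℝ≥0∞
  | 0, x, g, y => open Classical in if g = 0 ∧ x = y then 1 else 0
  | n + 1, x, g, y => open Classical in
      ∑ k, if 0 < g k ∧ ∀ l < k, g l = 0 then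
        ∑' a, M.arrivals (M.service i k) a *
          visitIn i n (depart x i k + a) (M.entitled i g k (depart x i k + a)) y
      else 0

/-- The probability that a visit to queue `i` that begins with joint queue lengths `x` ends, and
leaves the joint queue lengths `y`. -/
noncomputable def visit (i : Fin N) (x y : State K) : ℝ≥0∞ := ∑' n, M.visitIn i n x (x i) y

/-- The probability that the switch from queue `i` to the next queue changes the joint queue lengths
from `x` to `y`. -/
noncomputable def switch (i : Fin N) (x y : State K) : ℝ≥0∞ :=
  open Classical in ∑' a, if x + a = y then M.arrivals (M.switchover i) a else 0

/-- The transition probability of the joint queue lengths from a visit beginning to queue `i` to the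
next visit beginning, to queue `i + 1` (modulo `N`). -/
noncomputable def step (i : Fin N) (x y : State K) : ℝ≥0∞ := ∑' u, M.visit i x u * M.switch i u y

/-- `P i` is the steady-state law of the joint queue lengths at a visit beginning to queue `i`, for
all `i`: the laws are reproduced as the server moves around the cycle. -/
def IsSteadyState [NeZero N] (P : Fin N → PMF (State K)) : Prop :=
  ∀ i y, P (i + 1) y = ∑' x, P i x * M.step i x y

/-- The service time of an arbitrary type `j` customer: the mixture of the laws of the service times
of the levels with weights `λ_{jk} / λ_j`. -/
noncomputable def mixedService (j : Fin N) : ProbabilityMeasure ℝ≥0 :=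
  ⟨∑ k, (M.rate j k / M.totalRate j) • (M.service j k : Measure ℝ≥0), ⟨by
    have h : M.totalRate j ≠ 0 := (M.rate_pos j).ne'
    have h1 : ∑ k, M.rate j k / M.totalRate j = 1 := by
      rw [← Finset.sum_div]; exact div_self h
    simp only [Measure.coe_finsetSum, Finset.sum_apply, Measure.smul_apply, measure_univ]
    simp only [ENNReal.smul_def, smul_eq_mul, mul_one]
    exact_mod_cast h1⟩⟩

/-- The system without priorities: the same queues, disciplines and switch-over times, with a
single level in queue `j`, arrival rate `λ_j` and service times of arbitrary type `j` customers. -/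
noncomputable def withoutPriorities : System N (fun _ => 1) where
  discipline := M.discipline
  rate j _ := M.totalRate j
  rate_pos j := by simpa [totalRate] using M.rate_pos j
  service j _ := M.mixedService j
  switchover := M.switchover

end System

/-- The generating function of a law of joint queue lengths. The series converges absolutely when
`‖z j k‖ ≤ 1` for all `j` and `k`. -/
noncomputable def genFun {N : ℕ} {K : Fin N → ℕ} (p : PMF (State K))
    (z : (j : Fin N) → Fin (K j) → ℂ) : ℂ :=
  ∑' n : State K, ((p n).toReal : ℂ) * ∏ j, ∏ k, z j k ^ n j k

end Polling

/-!
Give the customers of the system without priorities independent random levels, level `k` in queue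
`j` with probability `λ_{jk} / λ_j`. This labelling intertwines the transitions of the two systems.
For arrivals, that is the thinning of Poisson processes. For visits, the law of the outcome does not
depend on the order of service, so the server may be thought to serve a customer who was chosen
regardless of his level; his service time is then distributed as `B_j`. Hence labelling turns the
given steady state into a steady state of the system with priorities, and its generating function is
a multinomial expansion.

That steady state is the only one: the positive part of the difference of two steady states is
stationary for the cycle of transitions. If it were not zero, it would charge the empty system,
which can be reached from every state, but it cannot do so for both orders of the difference.
-/

namespace Polling

variable {N : ℕ} {K : Fin N → ℕ}

section QueueLengths

/-- The joint queue lengths without regard to priorities, which are the states of a system with a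
single level in each queue. -/
abbrev QueueLengths (N : ℕ) : Type := State fun _ : Fin N => 1

/-- The numbers of customers in the queues, irrespective of their levels. -/
def total (x : State K) : QueueLengths N := fun j _ => ∑ k, x j k

/-- The state in which the only customer is one of type `j` and level `k`. -/
def customer (j : Fin N) (k : Fin (K j)) : State K := Pi.single j (Pi.single k 1)

@[simp] lemma total_zero : total (0 : State K) = 0 := by
  ext; simp [total]

lemma total_add (x y : State K) : total (x + y) = total x + total y := by
  ext; simp [total, Finset.sum_add_distrib]

@[simp] lemma customer_self (j : Fin N) (k : Fin (K j)) :
    (customer j k : State K) j = Pi.single k 1 :=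
  Pi.single_eq_same ..

lemma customer_of_ne {i j : Fin N} (h : i ≠ j) (k : Fin (K j)) : (customer j k : State K) i = 0 :=
  Pi.single_eq_of_ne h _

lemma customer_ne_zero (j : Fin N) (k : Fin (K j)) : (customer j k : State K) ≠ 0 := by
  simp [customer]

lemma add_customer_apply_ne_zero (x : State K) (j : Fin N) (k : Fin (K j)) :
    (x + customer j k) j ≠ 0 := fun h => by
  simpa using congrFun h k

lemma total_customer (j : Fin N) (k : Fin (K j)) :
    total (customer j k : State K) = customer j 0 := by
  ext i l
  rcases eq_or_ne i j with rfl | h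
  · simp [total, Subsingleton.elim l 0]
  · simp [total, customer_of_ne h]

lemma apply_eq_zero_of_total_apply_eq_zero {x : State K} {j : Fin N} (h : total x j = 0) :
    x j = 0 := by
  ext k
  exact Finset.sum_eq_zero_iff.1 (congrFun h 0) k (Finset.mem_univ k)

lemma total_eq_zero_iff {x : State K} : total x = 0 ↔ x = 0 := by
  refine ⟨fun h => ?_, by rintro rfl; exact total_zero⟩
  ext1 j
  exact apply_eq_zero_of_total_apply_eq_zero (congrFun h j)

lemma exists_eq_add_customer {x : State K} {j : Fin N} {k : Fin (K j)} (h : 0 < x j k) :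
    ∃ x', x = x' + customer j k := by
  have hle : customer j k ≤ x := by
    intro i
    rcases eq_or_ne i j with rfl | hi
    · rw [customer_self]
      intro l
      rcases eq_or_ne l k with rfl | hl
      · simpa [Nat.succ_le_iff] using h
      · simp [hl]
    · simp [customer_of_ne hi]
  exact ⟨x - customer j k, (tsub_add_cancel_of_le hle).symm⟩

lemma State.induction {motive : State K → Prop} (zero : motive 0)
    (add_customer : ∀ x j k, motive x → motive (x + customer j k)) (x : State K) : motive x := by
  induction x using WellFoundedLT.induction with
  | ind x ih =>
    by_cases hx : x = 0
    · rwa [hx]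
    obtain ⟨j, hj⟩ := Function.ne_iff.1 hx
    obtain ⟨k, hk⟩ := Function.ne_iff.1 hj
    obtain ⟨x, rfl⟩ := exists_eq_add_customer (Nat.pos_of_ne_zero hk)
    exact add_customer x j k
      (ih x (lt_add_of_pos_right x (pos_iff_ne_zero.2 (customer_ne_zero j k))))

lemma update_zero_add_single (x : State K) (i : Fin N) :
    Function.update x i 0 + Pi.single i (x i) = x := by
  ext1 j
  rcases eq_or_ne j i with rfl | h
  · simp
  · simp [h]

lemma exists_pos_forall_lt_eq_zero {ι : Type*} [Preorder ι] [WellFoundedLT ι] {g : ι → ℕ}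
    (hg : g ≠ 0) : ∃ k, 0 < g k ∧ ∀ l < k, g l = 0 := by
  obtain ⟨k, hk, hmin⟩ := exists_minimal_of_wellFoundedLT (fun k => 0 < g k) <| by
    simpa [Nat.pos_iff_ne_zero] using Function.ne_iff.1 hg
  exact ⟨k, hk, fun l hl => Nat.eq_zero_of_not_pos fun h => (hmin h hl.le).not_gt hl⟩

end QueueLengths

section Multinomial

variable {ι : Type*} [Fintype ι]

/-- The probability that independent trials with outcome probabilities `q`, as many as there are in
`v`, give each outcome `k` exactly `v k` times. -/
noncomputable def multinomialWeight (q : ι → ℝ≥0) (v : ι → ℕ) : ℝ≥0 :=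
  Nat.multinomial Finset.univ v * ∏ k, q k ^ v k

lemma multinomial_add_single_mul [DecidableEq ι] (v : ι → ℕ) (k : ι) :
    Nat.multinomial Finset.univ (v + Pi.single k 1) * (v k + 1) =
      Nat.multinomial Finset.univ v * (∑ l, v l + 1) := by
  have hfac : ∏ l, ((v + Pi.single k 1 : ι → ℕ) l).factorial =
      (v k + 1) * ∏ l, (v l).factorial := by
    rw [← Finset.mul_prod_erase _ _ (Finset.mem_univ k),
      ← Finset.mul_prod_erase _ (fun l => (v l).factorial) (Finset.mem_univ k), ← mul_assoc]
    congr 1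
    · simp [Nat.factorial_succ]
    · refine Finset.prod_congr rfl fun l hl => ?_
      simp [Finset.ne_of_mem_erase hl]
  have hsum : ∑ l, (v + Pi.single k 1 : ι → ℕ) l = ∑ l, v l + 1 := by
    simp [Finset.sum_add_distrib]
  have hspec := Nat.multinomial_spec Finset.univ (v + Pi.single k 1)
  rw [hfac, hsum, Nat.factorial_succ, ← Nat.multinomial_spec Finset.univ v] at hspec
  refine Nat.eq_of_mul_eq_mul_left (Finset.prod_pos (s := .univ) fun l _ => (v l).factorial_pos) ?_
  linear_combination hspec

lemma multinomialWeight_add_single_mul [DecidableEq ι] (q : ι → ℝ≥0) (v : ι → ℕ) (k : ι) :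
    multinomialWeight q (v + Pi.single k 1) * (v k + 1) =
      multinomialWeight q v * ((∑ l, v l + 1) * q k) := by
  have hcoeff : (Nat.multinomial Finset.univ (v + Pi.single k 1) : ℝ≥0) * (v k + 1) =
      Nat.multinomial Finset.univ v * (∑ l, (v l : ℝ≥0) + 1) := by
    exact_mod_cast multinomial_add_single_mul v k
  have hprod : ∏ l, q l ^ (v + Pi.single k 1 : ι → ℕ) l = (∏ l, q l ^ v l) * q k := by
    have hsingle : ∏ l, q l ^ (Pi.single k 1 : ι → ℕ) l = q k := by
      rw [Fintype.prod_eq_single k fun l hl => by simp [hl], Pi.single_eq_same, pow_one]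
    simp only [Pi.add_apply, pow_add, Finset.prod_mul_distrib, hsingle]
  rw [multinomialWeight, multinomialWeight, hprod]
  push_cast
  linear_combination ((∏ l, q l ^ v l) * q k) * hcoeff

lemma prod_poissonMeasure_singleton {q : ι → ℝ≥0} (hq : ∑ k, q k = 1) (r : ℝ≥0) (v : ι → ℕ) :
    ∏ k, poissonMeasure (q k * r) {v k} =
      poissonMeasure r {∑ k, v k} * multinomialWeight q v := by
  simp only [poissonMeasure_singleton, multinomialWeight]
  rw [← ENNReal.ofReal_prod_of_nonneg (fun _ _ => by positivity), ← ENNReal.ofReal_coe_nnreal,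
    ← ENNReal.ofReal_mul (by positivity)]
  congr 1
  have hexp : ∏ k, Real.exp (-(q k * r : ℝ≥0)) = Real.exp (-r) := by
    have hq' : ∑ k, (q k : ℝ) = 1 := by exact_mod_cast hq
    push_cast
    rw [← Real.exp_sum, Finset.sum_neg_distrib, ← Finset.sum_mul, hq', one_mul]
  have hspec : (∏ k, ((v k).factorial : ℝ)) * Nat.multinomial Finset.univ v =
      ((∑ k, v k).factorial : ℕ) := by
    exact_mod_cast Nat.multinomial_spec Finset.univ v
  have hfac : (∏ k, ((v k).factorial : ℝ)) ≠ 0 := by positivity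
  have hfac_sum : (((∑ k, v k).factorial : ℕ) : ℝ) ≠ 0 := by positivity
  rw [Finset.prod_div_distrib, Finset.prod_mul_distrib, hexp]
  push_cast
  simp only [mul_pow, Finset.prod_mul_distrib, Finset.prod_pow_eq_pow_sum]
  rw [div_mul_eq_mul_div, div_eq_div_iff hfac hfac_sum, ← hspec]
  ring

end Multinomial

section Labelling

/-- The states that arise from the queue lengths `m` when each customer is given a level. -/
def labellings (m : QueueLengths N) : Finset (State K) :=
  Fintype.piFinset fun j => Finset.piAntidiag Finset.univ (m j 0)

@[simp] lemma mem_labellings {m : QueueLengths N} {x : State K} :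
    x ∈ labellings m ↔ total x = m := by
  simp only [labellings, Fintype.mem_piFinset, Finset.mem_piAntidiag, funext_iff, total]
  refine forall_congr' fun j => ⟨fun h l => ?_, fun h => ⟨h 0, fun k _ => Finset.mem_univ k⟩⟩
  rw [Subsingleton.elim l 0, h.1]

lemma preimage_total_singleton (m : QueueLengths N) :
    total ⁻¹' {m} = ((labellings m : Finset (State K)) : Set (State K)) := by
  ext x
  simp

variable (p : (j : Fin N) → Fin (K j) → ℝ≥0)

/-- The probability that independent random levels, being `k` with probability `p j k` in queue `j`,
turn the queue lengths `total x` into `x`. -/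
noncomputable def labelWeight (x : State K) : ℝ≥0 := ∏ j, multinomialWeight (p j) (x j)

/-- The mean of `F` over the states that arise from the queue lengths `m` when the customers are
given independent random levels with law `p j` in queue `j`. -/
noncomputable def labelMean (m : QueueLengths N) (F : State K → ℝ≥0∞) : ℝ≥0∞ :=
  ∑ x ∈ labellings m, labelWeight p x * F x

lemma labelWeight_add_customer_mul (x : State K) (j : Fin N) (k : Fin (K j)) :
    labelWeight p (x + customer j k) * (x j k + 1) =
      labelWeight p x * ((total x j 0 + 1) * p j k) := by
  have hother : ∏ i ∈ Finset.univ.erase j, multinomialWeight (p i) ((x + customer j k) i) =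
      ∏ i ∈ Finset.univ.erase j, multinomialWeight (p i) (x i) :=
    Finset.prod_congr rfl fun i hi => by simp [customer_of_ne (Finset.ne_of_mem_erase hi)]
  have hself := multinomialWeight_add_single_mul (p j) (x j) k
  rw [labelWeight, labelWeight, ← Finset.mul_prod_erase _ _ (Finset.mem_univ j),
    ← Finset.mul_prod_erase _ (fun i => multinomialWeight (p i) (x i)) (Finset.mem_univ j), hother,
    Pi.add_apply, customer_self, total]
  push_cast at hself ⊢
  linear_combination (∏ i ∈ Finset.univ.erase j, multinomialWeight (p i) (x i)) * hself

lemma sum_labelWeight_smul_prod_pow {R : Type*} [CommSemiring R] [Algebra ℝ≥0 R]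
    (m : QueueLengths N) (z : (j : Fin N) → Fin (K j) → R) :
    ∑ x ∈ labellings m, labelWeight p x • ∏ j, ∏ k, z j k ^ x j k =
      ∏ j, (∑ k, p j k • z j k) ^ m j 0 := by
  simp only [Finset.sum_pow_eq_sum_piAntidiag, Finset.prod_univ_sum, labellings, labelWeight,
    multinomialWeight, Algebra.smul_def, mul_pow, Finset.prod_mul_distrib, map_mul, map_prod,
    map_pow, map_natCast, mul_assoc]

lemma labelMean_const (hp : ∀ j, ∑ k, p j k = 1) (m : QueueLengths N) (c : ℝ≥0∞) :
    labelMean p m (fun _ => c) = c := by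
  have h : ∑ x ∈ labellings m, labelWeight p x = 1 := by
    simpa [hp] using sum_labelWeight_smul_prod_pow p m fun _ _ => (1 : ℝ≥0)
  rw [labelMean, ← Finset.sum_mul, ← ENNReal.ofNNReal_finsetSum, h, ENNReal.coe_one, one_mul]

variable {p}

lemma labelMean_congr {m : QueueLengths N} {F G : State K → ℝ≥0∞}
    (h : ∀ x, total x = m → F x = G x) : labelMean p m F = labelMean p m G :=
  Finset.sum_congr rfl fun x hx => by rw [h x (mem_labellings.1 hx)]

lemma labelMean_zero (F : State K → ℝ≥0∞) : labelMean p 0 F = F 0 := by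
  have h : (labellings 0 : Finset (State K)) = {0} := by
    ext x
    simp [total_eq_zero_iff]
  simp [labelMean, h, labelWeight, multinomialWeight, Nat.multinomial]

lemma labelMean_const_mul (m : QueueLengths N) (c : ℝ≥0∞) (F : State K → ℝ≥0∞) :
    labelMean p m (fun x => c * F x) = c * labelMean p m F := by
  simp only [labelMean, Finset.mul_sum, mul_left_comm]

lemma labelMean_tsum {ι : Type*} (m : QueueLengths N) (F : ι → State K → ℝ≥0∞) :
    labelMean p m (fun x => ∑' a, F a x) = ∑' a, labelMean p m (F a) := by
  simp only [labelMean, ← ENNReal.tsum_mul_left]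
  rw [Summable.tsum_finsetSum fun _ _ => ENNReal.summable]

lemma labelMean_sum {ι : Type*} [Fintype ι] (m : QueueLengths N) (F : ι → State K → ℝ≥0∞) :
    labelMean p m (fun x => ∑ a, F a x) = ∑ a, labelMean p m (F a) := by
  simpa only [tsum_fintype] using labelMean_tsum m F

lemma labelMean_comm (m m' : QueueLengths N) (F : State K → State K → ℝ≥0∞) :
    labelMean p m (fun x => labelMean p m' (F x)) =
      labelMean p m' (fun y => labelMean p m fun x => F x y) := by
  simp only [labelMean, Finset.mul_sum]
  rw [Finset.sum_comm]
  simp only [mul_left_comm]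

lemma labelMean_ite_eq (m : QueueLengths N) (y : State K) :
    labelMean p m (fun x => if x = y then 1 else 0) =
      if m = total y then (labelWeight p y : ℝ≥0∞) else 0 := by
  simp [labelMean, eq_comm]

lemma tsum_mul_labelMean (f : QueueLengths N → ℝ≥0∞) (F : State K → ℝ≥0∞) :
    ∑' m, f m * labelMean p m F = ∑' x, f (total x) * labelWeight p x * F x := by
  rw [← ENNReal.tsum_fiberwise (fun x : State K => f (total x) * labelWeight p x * F x) total]
  refine tsum_congr fun m => ?_
  rw [preimage_total_singleton,
    Finset.tsum_subtype' _ fun x => f (total x) * labelWeight p x * F x, labelMean, Finset.mul_sum]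
  refine Finset.sum_congr rfl fun x hx => ?_
  rw [mem_labellings.1 hx, mul_assoc]

lemma sum_labellings_add_customer {A : Type*} [AddCommMonoid A] (m : QueueLengths N) (j : Fin N)
    (k : Fin (K j)) {F : State K → A} (hF : ∀ x, x j k = 0 → F x = 0) :
    ∑ x ∈ labellings (m + customer j 0), F x = ∑ x ∈ labellings m, F (x + customer j k) := by
  refine (Finset.sum_of_injOn (· + customer j k) (add_left_injective _).injOn ?_ ?_
    fun _ _ => rfl).symm
  · intro x hx
    simpa [total_add, total_customer] using hx
  · intro x hx hx'
    by_contra h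
    obtain ⟨y, rfl⟩ := exists_eq_add_customer (Nat.pos_of_ne_zero fun h0 => h (hF x h0))
    refine hx' ⟨y, ?_, rfl⟩
    simpa [total_add, total_customer] using hx

lemma labelMean_add_customer (m : QueueLengths N) (j : Fin N) (F : State K → ℝ≥0∞) :
    labelMean p (m + customer j 0) F =
      ∑ k, (p j k : ℝ≥0∞) * labelMean p m (fun x => F (x + customer j k)) := by
  -- After multiplication by the number of customers in queue `j`, split it as `∑ k, x j k`.
  have hne : ((m j 0 + 1 : ℕ) : ℝ≥0∞) ≠ 0 := by simp
  refine (ENNReal.mul_right_inj hne (ENNReal.natCast_ne_top _)).1 ?_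
  calc ((m j 0 + 1 : ℕ) : ℝ≥0∞) * labelMean p (m + customer j 0) F
    _ = ∑ k, ∑ x ∈ labellings (m + customer j 0), (x j k : ℝ≥0∞) * (labelWeight p x * F x) := by
        rw [labelMean, Finset.mul_sum, Finset.sum_comm]
        refine Finset.sum_congr rfl fun x hx => ?_
        have hx : ∑ k, x j k = m j 0 + 1 := by
          simpa [total] using congrFun (congrFun (mem_labellings.1 hx) j) 0
        rw [← hx, Nat.cast_sum, Finset.sum_mul]
    _ = ∑ k, ∑ x ∈ labellings m, ((x j k + 1 : ℕ) : ℝ≥0∞) *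
          (labelWeight p (x + customer j k) * F (x + customer j k)) := by
        refine Finset.sum_congr rfl fun k _ => ?_
        rw [sum_labellings_add_customer m j k fun x hx => by simp [hx]]
        simp
    _ = ((m j 0 + 1 : ℕ) : ℝ≥0∞) *
          ∑ k, (p j k : ℝ≥0∞) * labelMean p m (fun x => F (x + customer j k)) := by
        simp only [labelMean, Finset.mul_sum]
        refine Finset.sum_congr rfl fun k _ => Finset.sum_congr rfl fun x hx => ?_
        have hw : (labelWeight p (x + customer j k) : ℝ≥0∞) * ((x j k + 1 : ℕ) : ℝ≥0∞) =
            labelWeight p x * (((m j 0 + 1 : ℕ) : ℝ≥0∞) * p j k) := by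
          rw [← mem_labellings.1 hx]
          exact_mod_cast labelWeight_add_customer_mul p x j k
        rw [← mul_assoc, mul_comm _ (labelWeight p _ : ℝ≥0∞), hw]
        ring

lemma labelMean_add (m m' : QueueLengths N) (F : State K → ℝ≥0∞) :
    labelMean p (m + m') F = labelMean p m (fun x => labelMean p m' (fun y => F (x + y))) := by
  induction m' using State.induction generalizing F with
  | zero => simp [labelMean_zero]
  | add_customer m' j k ih =>
    rw [Subsingleton.elim k 0, ← add_assoc, labelMean_add_customer]
    simp only [labelMean_add_customer, labelMean_sum, labelMean_const_mul, ih, add_assoc]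

lemma labelMean_update_single (i : Fin N) (m : QueueLengths N) (F : State K → State K → ℝ≥0∞) :
    labelMean p m (fun x => F (Function.update x i 0) (Pi.single i (x i))) =
      labelMean p (Function.update m i 0) fun r => labelMean p (Pi.single i (m i)) (F r) := by
  conv_lhs => rw [← update_zero_add_single m i, labelMean_add]
  refine labelMean_congr fun r hr => labelMean_congr fun s hs => ?_
  have hri : r i = 0 := apply_eq_zero_of_total_apply_eq_zero (by simp [hr])
  have hsj : ∀ j ≠ i, s j = 0 := fun j hj => apply_eq_zero_of_total_apply_eq_zero (by simp [hs, hj])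
  congr 1 <;> ext1 j
  · rcases eq_or_ne j i with rfl | h
    · simp [hri]
    · simp [h, hsj j h]
  · rcases eq_or_ne j i with rfl | h
    · simp [hri]
    · simp [h, hsj j h]

/-- The law of the state when the joint queue lengths have law `q` and the customers are given
independent random levels with law `p j` in queue `j`. -/
noncomputable def labelled (hp : ∀ j, ∑ k, p j k = 1) (q : PMF (QueueLengths N)) :
    PMF (State K) :=
  ⟨fun x => q (total x) * labelWeight p x, by
    have h := tsum_mul_labelMean (p := p) q fun _ => 1
    simp only [mul_one, labelMean_const p hp, q.tsum_coe] at h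
    rw [h]
    exact ENNReal.summable.hasSum⟩

lemma labelled_apply (hp : ∀ j, ∑ k, p j k = 1) (q : PMF (QueueLengths N)) (x : State K) :
    labelled hp q x = q (total x) * labelWeight p x := rfl

lemma summable_genFun (q : PMF (State K)) {z : (j : Fin N) → Fin (K j) → ℂ}
    (hz : ∀ j k, ‖z j k‖ ≤ 1) :
    Summable fun x => ((q x).toReal : ℂ) * ∏ j, ∏ k, z j k ^ x j k := by
  refine Summable.of_norm_bounded (ENNReal.summable_toReal q.tsum_coe_ne_top) fun x => ?_
  rw [norm_mul, Complex.norm_real, Real.norm_of_nonneg ENNReal.toReal_nonneg]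
  refine mul_le_of_le_one_right ENNReal.toReal_nonneg ?_
  simp only [norm_prod, norm_pow]
  exact Finset.prod_le_one (fun _ _ => Finset.prod_nonneg fun _ _ => by positivity) fun j _ =>
    Finset.prod_le_one (fun _ _ => by positivity) fun k _ =>
      pow_le_one₀ (norm_nonneg _) (hz j k)

lemma genFun_labelled (hp : ∀ j, ∑ k, p j k = 1) (q : PMF (QueueLengths N))
    {z : (j : Fin N) → Fin (K j) → ℂ} (hz : ∀ j k, ‖z j k‖ ≤ 1) :
    genFun (labelled hp q) z = genFun q fun j _ => ∑ k, p j k • z j k := by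
  rw [genFun, ← ((summable_genFun _ hz).hasSum.tsum_fiberwise total).tsum_eq, genFun]
  refine tsum_congr fun m => ?_
  rw [preimage_total_singleton, Finset.tsum_subtype' _
    fun x => ((labelled hp q x).toReal : ℂ) * ∏ j, ∏ k, z j k ^ x j k]
  simp only [Finset.univ_unique, Finset.prod_singleton, Fin.default_eq_zero,
    ← sum_labelWeight_smul_prod_pow, Finset.mul_sum]
  refine Finset.sum_congr rfl fun x hx => ?_
  rw [labelled_apply, mem_labellings.1 hx]
  simp [mul_assoc, NNReal.smul_def]

/-- Random labelling intertwines the transition kernels `T` of states and `T'` of queue lengths: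
giving the customers random levels and then moving by `T` has the same effect as moving by `T'` and
then giving the customers random levels. -/
def Intertwines (p : (j : Fin N) → Fin (K j) → ℝ≥0) (T : State K → State K → ℝ≥0∞)
    (T' : QueueLengths N → QueueLengths N → ℝ≥0∞) : Prop :=
  ∀ m y, labelMean p m (fun x => T x y) = T' m (total y) * labelWeight p y

namespace Intertwines

variable {S T : State K → State K → ℝ≥0∞} {S' T' : QueueLengths N → QueueLengths N → ℝ≥0∞}

lemma tsum_labelWeight_mul (h : Intertwines p T T') (f : QueueLengths N → ℝ≥0∞) (y : State K) :
    ∑' x, f (total x) * labelWeight p x * T x y =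
      (∑' m, f m * T' m (total y)) * labelWeight p y := by
  rw [← tsum_mul_labelMean f fun x => T x y, ← ENNReal.tsum_mul_right]
  simp only [h _ y, mul_assoc]

lemma comp (h : Intertwines p S S') (h' : Intertwines p T T') :
    Intertwines p (fun x y => ∑' u, S x u * T u y) fun m n => ∑' u, S' m u * T' u n := by
  intro m y
  rw [labelMean_tsum, ← h'.tsum_labelWeight_mul]
  refine tsum_congr fun u => ?_
  simp only [mul_comm _ (T u y)]
  rw [labelMean_const_mul, h]

end Intertwines

end Labelling

namespace Discipline

variable (d : Discipline)

/-- Among the arrivals `a` during a service in queue `i`, those served in the current visit. -/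
def joining (i : Fin N) (a : State K) : State K :=
  match d with
  | .gated => 0
  | .exhaustive => Pi.single i (a i)

/-- Among the arrivals `a` during a service in queue `i`, those not served in the current visit. -/
def waiting (i : Fin N) (a : State K) : State K :=
  match d with
  | .gated => a
  | .exhaustive => Function.update a i 0

lemma waiting_add_joining (i : Fin N) (a : State K) : d.waiting i a + d.joining i a = a := by
  cases d with
  | gated => simp [waiting, joining]
  | exhaustive => exact update_zero_add_single a i

@[simp] lemma waiting_zero (i : Fin N) : d.waiting i (0 : State K) = 0 := by
  cases d <;> simp [waiting]

@[simp] lemma joining_zero (i : Fin N) : d.joining i (0 : State K) = 0 := by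
  cases d <;> simp [joining]

lemma labelMean_waiting_joining {p : (j : Fin N) → Fin (K j) → ℝ≥0} (i : Fin N)
    (m : QueueLengths N) (F : State K → State K → ℝ≥0∞) :
    labelMean p m (fun x => F (d.waiting i x) (d.joining i x)) =
      labelMean p (d.waiting i m) fun r => labelMean p (d.joining i m) (F r) := by
  cases d with
  | gated => simp [waiting, joining, labelMean_zero]
  | exhaustive => exact labelMean_update_single i m F

/-- During a visit to queue `i` under the discipline `d`, the customers present may be made up of
`s`, who are still to be served in this visit, and `r`, who are not. -/
structure IsSplit (i : Fin N) (r s : State K) : Prop where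
  apply_of_ne : ∀ j ≠ i, s j = 0
  apply_self : d = .exhaustive → r i = 0

lemma isSplit_update_single (i : Fin N) (x : State K) :
    d.IsSplit i (Function.update x i 0) (Pi.single i (x i)) :=
  ⟨fun j hj => by simp [hj], fun _ => by simp⟩

namespace IsSplit

variable {d} {i : Fin N} {r s : State K}

lemma eq_zero_iff (h : d.IsSplit i r s) : s i = 0 ↔ s = 0 := by
  refine ⟨fun hi => ?_, fun hs => by simp [hs]⟩
  ext1 j
  rcases eq_or_ne j i with rfl | hj
  · exact hi
  · exact h.apply_of_ne j hj

lemma of_add_customer {k : Fin (K i)} (h : d.IsSplit i r (s + customer i k)) : d.IsSplit i r s :=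
  ⟨fun j hj => by simpa [customer_of_ne hj] using h.apply_of_ne j hj, h.apply_self⟩

lemma of_total (h : d.IsSplit i (total r) (total s)) : d.IsSplit i r s :=
  ⟨fun j hj => apply_eq_zero_of_total_apply_eq_zero (h.apply_of_ne j hj),
    fun hd => apply_eq_zero_of_total_apply_eq_zero (h.apply_self hd)⟩

lemma add_arrivals (h : d.IsSplit i r s) (a : State K) :
    d.IsSplit i (r + d.waiting i a) (s + d.joining i a) where
  apply_of_ne j hj := by cases d <;> simp [joining, h.apply_of_ne j hj, hj]
  apply_self hd := by
    subst hd
    simp [waiting, h.apply_self]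

end IsSplit

end Discipline

namespace System

variable (M : System N K)

section Arrivals

/-- The probability that an arbitrary type `j` customer has level `k`. -/
noncomputable def levelProb (j : Fin N) (k : Fin (K j)) : ℝ≥0 := M.rate j k / M.totalRate j

lemma levelProb_mul_totalRate (j : Fin N) (k : Fin (K j)) :
    M.levelProb j k * M.totalRate j = M.rate j k :=
  div_mul_cancel₀ _ (M.rate_pos j).ne'

lemma sum_levelProb (j : Fin N) : ∑ k, M.levelProb j k = 1 := by
  simp only [levelProb, ← Finset.sum_div]
  exact div_self (M.rate_pos j).ne'

lemma sum_levelProb_smul (j : Fin N) (z : Fin (K j) → ℂ) :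
    ∑ k, M.levelProb j k • z k =
      (1 / ((M.totalRate j : ℝ) : ℂ)) * ∑ k, ((M.rate j k : ℝ) : ℂ) * z k := by
  rw [Finset.mul_sum]
  refine Finset.sum_congr rfl fun k _ => ?_
  simp [levelProb, NNReal.smul_def, div_eq_inv_mul, mul_assoc]

lemma measurable_prod_poissonMeasure_singleton (a : State K) :
    Measurable fun t : ℝ≥0 => ∏ j, ∏ k, poissonMeasure (M.rate j k * t) {a j k} := by
  simp only [poissonMeasure_singleton]
  fun_prop

lemma tsum_prod_poissonMeasure_singleton (t : ℝ≥0) :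
    ∑' a : State K, ∏ j, ∏ k, poissonMeasure (M.rate j k * t) {a j k} = 1 := by
  let μ : Measure (State K) :=
    Measure.pi fun j => Measure.pi fun k => poissonMeasure (M.rate j k * t)
  have hμ : ∀ a : State K, ∏ j, ∏ k, poissonMeasure (M.rate j k * t) {a j k} = μ {a} := fun a => by
    simp only [μ, Measure.pi_singleton]
  simpa [hμ] using (lintegral_countable' (μ := μ) fun _ => 1).symm

lemma tsum_arrivals (τ : ProbabilityMeasure ℝ≥0) : ∑' a, M.arrivals τ a = 1 := by
  simp only [arrivals]
  rw [← lintegral_tsum fun a => (M.measurable_prod_poissonMeasure_singleton a).aemeasurable]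
  simp [tsum_prod_poissonMeasure_singleton]

lemma arrivals_zero_pos (τ : ProbabilityMeasure ℝ≥0) : 0 < M.arrivals τ 0 := by
  have hpos (t : ℝ≥0) : ∏ j, ∏ k, poissonMeasure (M.rate j k * t) {(0 : State K) j k} ≠ 0 := by
    simp [Finset.prod_ne_zero_iff, poissonMeasure_singleton, Real.exp_pos]
  rw [arrivals, lintegral_pos_iff_support (M.measurable_prod_poissonMeasure_singleton 0),
    Set.eq_univ_of_forall (s := Function.support _) hpos]
  simp

lemma arrivals_eq (τ : ProbabilityMeasure ℝ≥0) (a : State K) :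
    M.arrivals τ a =
      M.withoutPriorities.arrivals τ (total a) * labelWeight M.levelProb a := by
  simp only [arrivals]
  rw [← lintegral_mul_const _
    (M.withoutPriorities.measurable_prod_poissonMeasure_singleton (total a))]
  refine lintegral_congr fun t => ?_
  rw [labelWeight, ENNReal.ofNNReal_finsetProd, ← Finset.prod_mul_distrib]
  refine Finset.prod_congr rfl fun j _ => ?_
  have h := prod_poissonMeasure_singleton (M.sum_levelProb j) (M.totalRate j * t) (a j)
  simp only [← mul_assoc, levelProb_mul_totalRate] at h
  simp [h, withoutPriorities, total]

lemma tsum_arrivals_mul (τ : ProbabilityMeasure ℝ≥0) (F : State K → ℝ≥0∞) :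
    ∑' a, M.arrivals τ a * F a =
      ∑' m, M.withoutPriorities.arrivals τ m * labelMean M.levelProb m F := by
  simp only [tsum_mul_labelMean, ← arrivals_eq]

lemma sum_levelProb_mul_arrivals (j : Fin N) (m : QueueLengths N) :
    ∑ k, (M.levelProb j k : ℝ≥0∞) * M.withoutPriorities.arrivals (M.service j k) m =
      M.withoutPriorities.arrivals (M.mixedService j) m := by
  simp only [arrivals, mixedService, ProbabilityMeasure.coe_mk]
  rw [lintegral_finsetSum_measure]
  refine Finset.sum_congr rfl fun k _ => ?_
  rw [lintegral_smul_measure]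
  rfl

end Arrivals

section Visits

lemma depart_add_customer (x : State K) (i : Fin N) (k : Fin (K i)) :
    depart (x + customer i k) i k = x := by
  ext j l
  rcases eq_or_ne j i with rfl | h
  · rcases eq_or_ne l k with rfl | h'
    · simp [depart]
    · simp [depart, h']
  · simp [depart, customer_of_ne h, h]

lemma visitIn_succ {i : Fin N} {g : Fin (K i) → ℕ} {k : Fin (K i)} (hk : 0 < g k)
    (hlt : ∀ l < k, g l = 0) (n : ℕ) (x y : State K) :
    M.visitIn i (n + 1) x g y = ∑' a, M.arrivals (M.service i k) a *
      M.visitIn i n (depart x i k + a) (M.entitled i g k (depart x i k + a)) y := by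
  rw [visitIn, Fintype.sum_eq_single k, if_pos ⟨hk, hlt⟩]
  refine fun l hl => if_neg fun ⟨hl_pos, hl_lt⟩ => ?_
  rcases hl.lt_or_gt with h | h
  · exact hl_pos.ne' (hlt l h)
  · exact hk.ne' (hl_lt k h)

lemma visitIn_succ_zero (i : Fin N) (n : ℕ) (x y : State K) : M.visitIn i (n + 1) x 0 y = 0 := by
  simp [visitIn]

/-- The probability that a visit to queue `i` ends after exactly `n` further services with joint
queue lengths `y`, if `s` are the customers still to be served and `r` the others present. -/
noncomputable def continueVisit (i : Fin N) (n : ℕ) (r s y : State K) : ℝ≥0∞ :=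
  M.visitIn i n (r + s) (s i) y

/-- The probability that a visit to queue `i` ends after exactly `n + 1` further services, the first
of which is given to a level `k` customer, with joint queue lengths `y`, if `s` are the other
customers still to be served and `r` those who are not to be served. -/
noncomputable def serveFirst (i : Fin N) (k : Fin (K i)) (n : ℕ) (r s y : State K) : ℝ≥0∞ :=
  ∑' a, M.arrivals (M.service i k) a * M.continueVisit i n
    (r + (M.discipline i).waiting i a) (s + (M.discipline i).joining i a) y

variable {M} {i : Fin N} {r s : State K}

lemma continueVisit_zero (h : (M.discipline i).IsSplit i r s) (y : State K) :
    M.continueVisit i 0 r s y = if s = 0 ∧ r = y then 1 else 0 := by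
  simp only [continueVisit, visitIn, h.eq_zero_iff]
  rcases eq_or_ne s 0 with rfl | hs
  · simp
  · simp [hs]

lemma continueVisit_succ_of_highest (hr : M.discipline i = .exhaustive → r i = 0) {k : Fin (K i)}
    (hlt : ∀ l < k, s i l = 0) (n : ℕ) (y : State K) :
    M.continueVisit i (n + 1) r (s + customer i k) y = M.serveFirst i k n r s y := by
  rw [continueVisit, M.visitIn_succ (k := k) (by simp)
    fun l hl => by simp [hlt l hl, hl.ne], serveFirst]
  refine tsum_congr fun a => ?_
  congr 1
  rw [← add_assoc, depart_add_customer, continueVisit, add_add_add_comm r,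
    Discipline.waiting_add_joining, Pi.add_apply, customer_self, entitled]
  congr 1
  cases hd : M.discipline i with
  | gated =>
    ext l
    rcases eq_or_ne l k with rfl | hl
    · simp [Discipline.joining]
    · simp [Discipline.joining, hl]
  | exhaustive => simp [Discipline.joining, hr hd]

lemma serveFirst_zero_add_customer (k l : Fin (K i)) (r s y : State K) :
    M.serveFirst i k 0 r (s + customer i l) y = 0 := by
  refine ENNReal.tsum_eq_zero.2 fun a => mul_eq_zero_of_right _ (if_neg fun h => ?_)
  rw [add_right_comm] at h
  exact add_customer_apply_ne_zero _ _ _ h.1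

lemma continueVisit_succ_of_serveFirst_comm {n : ℕ} {y : State K}
    (hcomm : ∀ {s} (k l : Fin (K i)), (M.discipline i).IsSplit i r s →
      M.serveFirst i l n r (s + customer i k) y = M.serveFirst i k n r (s + customer i l) y)
    (h : (M.discipline i).IsSplit i r s) (k : Fin (K i)) :
    M.continueVisit i (n + 1) r (s + customer i k) y = M.serveFirst i k n r s y := by
  obtain ⟨l, hl, hlt⟩ := exists_pos_forall_lt_eq_zero (add_customer_apply_ne_zero s i k)
  rcases eq_or_ne l k with rfl | hlk
  · exact continueVisit_succ_of_highest h.apply_self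
      (fun l' hl' => (add_eq_zero.1 (hlt l' hl')).1) n y
  obtain ⟨s, rfl⟩ : ∃ s', s = s' + customer i l :=
    exists_eq_add_customer (by simpa [hlk] using hl)
  rw [add_right_comm] at hlt ⊢
  rw [continueVisit_succ_of_highest h.apply_self
    fun l' hl' => (add_eq_zero.1 (hlt l' hl')).1]
  exact hcomm k l h.of_add_customer

/-- Whichever of the two customers is served first, by induction the other one may come next, and
the two services then contribute the same double sum over the arrivals. -/
lemma serveFirst_comm (h : (M.discipline i).IsSplit i r s) (k l : Fin (K i)) (n : ℕ)
    (y : State K) :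
    M.serveFirst i l n r (s + customer i k) y = M.serveFirst i k n r (s + customer i l) y := by
  induction n generalizing r s k l with
  | zero => simp only [serveFirst_zero_add_customer]
  | succ n ih =>
    have hserve (k l : Fin (K i)) : M.serveFirst i l (n + 1) r (s + customer i k) y =
        ∑' a, ∑' b, M.arrivals (M.service i l) a * (M.arrivals (M.service i k) b *
          M.continueVisit i n
            (r + (M.discipline i).waiting i a + (M.discipline i).waiting i b)
            (s + (M.discipline i).joining i a + (M.discipline i).joining i b) y) := by
      refine tsum_congr fun a => ?_
      rw [ENNReal.tsum_mul_left, add_right_comm,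
        continueVisit_succ_of_serveFirst_comm (fun k l h => ih h k l) (h.add_arrivals a),
        serveFirst]
    rw [hserve, hserve, ENNReal.tsum_comm]
    refine tsum_congr fun b => tsum_congr fun a => ?_
    rw [mul_left_comm, add_right_comm r, add_right_comm s]

lemma continueVisit_succ (h : (M.discipline i).IsSplit i r s) (k : Fin (K i)) (n : ℕ)
    (y : State K) :
    M.continueVisit i (n + 1) r (s + customer i k) y = M.serveFirst i k n r s y :=
  continueVisit_succ_of_serveFirst_comm (fun k l h => serveFirst_comm h k l n y) h k

lemma visit_eq_tsum_continueVisit (i : Fin N) (x y : State K) :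
    M.visit i x y =
      ∑' n, M.continueVisit i n (Function.update x i 0) (Pi.single i (x i)) y := by
  simp only [visit, continueVisit, update_zero_add_single, Pi.single_eq_same]

lemma switch_eq (i : Fin N) (x y : State K) :
    M.switch i x y = ∑' a, M.arrivals (M.switchover i) a * if x + a = y then 1 else 0 := by
  simp only [switch, mul_ite, mul_one, mul_zero]

end Visits

section RandomLevels

lemma sum_levelProb_mul_serveFirst (i : Fin N) (n : ℕ) (r s y : State K) :
    ∑ k, (M.levelProb i k : ℝ≥0∞) * M.serveFirst i k n r s y =
      ∑' m, M.withoutPriorities.arrivals (M.mixedService i) m *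
        labelMean M.levelProb ((M.discipline i).waiting i m) fun a =>
          labelMean M.levelProb ((M.discipline i).joining i m) fun b =>
            M.continueVisit i n (r + a) (s + b) y := by
  simp only [serveFirst, tsum_arrivals_mul M, ← sum_levelProb_mul_arrivals, Finset.sum_mul]
  rw [Summable.tsum_finsetSum fun _ _ => ENNReal.summable]
  refine Finset.sum_congr rfl fun k _ => ?_
  rw [← ENNReal.tsum_mul_left]
  refine tsum_congr fun m => ?_
  rw [mul_assoc, (M.discipline i).labelMean_waiting_joining i m fun a b =>
    M.continueVisit i n (r + a) (s + b) y]

variable {M} {i : Fin N} {r s : QueueLengths N}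

lemma labelMean_continueVisit_zero (h : (M.discipline i).IsSplit i r s) (y : State K) :
    labelMean M.levelProb r (fun r' => labelMean M.levelProb s fun s' =>
        M.continueVisit i 0 r' s' y) =
      M.withoutPriorities.continueVisit i 0 r s (total y) * labelWeight M.levelProb y := by
  have hzero : labelMean M.levelProb r (fun r' => labelMean M.levelProb s fun s' =>
        M.continueVisit i 0 r' s' y) =
      labelMean M.levelProb s fun _ => labelMean M.levelProb r fun r' =>
        if s = 0 then (if r' = y then 1 else 0) else 0 := by
    rw [labelMean_comm]
    refine labelMean_congr fun s' hs => labelMean_congr fun r' hr => ?_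
    subst hr hs
    simp only [continueVisit_zero h.of_total, total_eq_zero_iff, ite_and]
  rw [hzero, labelMean_const _ M.sum_levelProb, continueVisit_zero (M := M.withoutPriorities) h]
  rcases eq_or_ne s 0 with hs | hs
  · simp [hs, labelMean_ite_eq]
  · simp [hs, labelMean]

lemma labelMean_continueVisit_succ (h : (M.discipline i).IsSplit i r s) (n : ℕ) (y : State K) :
    labelMean M.levelProb r (fun r' => labelMean M.levelProb (s + customer i 0) fun s' =>
        M.continueVisit i (n + 1) r' s' y) =
      ∑' m, M.withoutPriorities.arrivals (M.mixedService i) m *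
        labelMean M.levelProb (r + (M.discipline i).waiting i m) fun r' =>
          labelMean M.levelProb (s + (M.discipline i).joining i m) fun s' =>
            M.continueVisit i n r' s' y := by
  calc
    _ = labelMean M.levelProb r fun r' => labelMean M.levelProb s fun s' =>
          ∑ k, (M.levelProb i k : ℝ≥0∞) * M.serveFirst i k n r' s' y := by
        refine labelMean_congr fun r' hr => ?_
        simp only [labelMean_add_customer, labelMean_sum, labelMean_const_mul]
        refine Finset.sum_congr rfl fun k _ => congrArg _ (labelMean_congr fun s' hs => ?_)
        subst hr hs
        exact continueVisit_succ h.of_total k n y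
    _ = _ := by
        simp only [sum_levelProb_mul_serveFirst, labelMean_tsum, labelMean_const_mul,
          labelMean_add]
        refine tsum_congr fun m => congrArg _ (labelMean_congr fun r' _ => ?_)
        rw [labelMean_comm]

lemma labelMean_continueVisit (h : (M.discipline i).IsSplit i r s) (n : ℕ) (y : State K) :
    labelMean M.levelProb r (fun r' => labelMean M.levelProb s fun s' =>
        M.continueVisit i n r' s' y) =
      M.withoutPriorities.continueVisit i n r s (total y) * labelWeight M.levelProb y := by
  induction n generalizing r s with
  | zero => exact labelMean_continueVisit_zero h y
  | succ n ih =>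
    rcases eq_or_ne s 0 with rfl | hs
    · simp only [labelMean_zero, continueVisit, Pi.zero_apply, visitIn_succ_zero, zero_mul,
        labelMean_const _ M.sum_levelProb]
    · obtain ⟨s, rfl⟩ : ∃ s', s = s' + customer i 0 := by
        refine exists_eq_add_customer (Nat.pos_of_ne_zero fun hi => hs (h.eq_zero_iff.1 ?_))
        ext l
        rwa [Subsingleton.elim l 0]
      have h := h.of_add_customer
      rw [labelMean_continueVisit_succ h, continueVisit_succ (M := M.withoutPriorities) h,
        serveFirst, ← ENNReal.tsum_mul_right]
      refine tsum_congr fun m => ?_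
      rw [ih (h.add_arrivals m), mul_assoc]
      rfl

variable (M) (i)

lemma intertwines_visit :
    Intertwines M.levelProb (M.visit i) (M.withoutPriorities.visit i) := by
  intro m y
  simp only [visit_eq_tsum_continueVisit, labelMean_tsum, ← ENNReal.tsum_mul_right]
  refine tsum_congr fun n => ?_
  rw [labelMean_update_single i m fun r s => M.continueVisit i n r s y,
    labelMean_continueVisit ((M.discipline i).isSplit_update_single i m)]

lemma intertwines_switch :
    Intertwines M.levelProb (M.switch i) (M.withoutPriorities.switch i) := by
  intro m y
  simp only [switch_eq, tsum_arrivals_mul M, labelMean_tsum, ← ENNReal.tsum_mul_right,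
    labelMean_const_mul]
  refine tsum_congr fun a => ?_
  rw [← labelMean_add m a fun x => if x = y then 1 else 0, labelMean_ite_eq, mul_assoc, ite_mul,
    one_mul, zero_mul]
  rfl

lemma intertwines_step : Intertwines M.levelProb (M.step i) (M.withoutPriorities.step i) :=
  (M.intertwines_visit i).comp (M.intertwines_switch i)

lemma isSteadyState_labelled [NeZero N] {P : Fin N → PMF (QueueLengths N)}
    (hP : M.withoutPriorities.IsSteadyState P) :
    M.IsSteadyState fun i => labelled M.sum_levelProb (P i) := by
  intro i y
  simp only [labelled_apply, hP i, (M.intertwines_step i).tsum_labelWeight_mul]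

end RandomLevels
end System

section StationaryLaws

variable {α : Type*} {T : α → α → ℝ≥0∞} {μ ν : α → ℝ≥0∞}

/-- The weights `μ`, not necessarily of total mass `1`, are reproduced by the transition kernel
`T`. -/
def IsStationary (T : α → α → ℝ≥0∞) (μ : α → ℝ≥0∞) : Prop := ∀ y, μ y = ∑' x, μ x * T x y

lemma eq_of_le_of_tsum_le (h : μ ≤ ν) (hμ : ∑' x, μ x ≠ ∞) (hνμ : ∑' x, ν x ≤ ∑' x, μ x) :
    μ = ν := by
  ext x
  by_contra hne
  exact (ENNReal.tsum_lt_tsum hμ h (lt_of_le_of_ne (h x) hne)).not_ge hνμ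

namespace IsStationary

lemma pos_of_reaches (h : IsStationary T μ) {x y : α}
    (hxy : Relation.ReflTransGen (fun x y => 0 < T x y) x y) (hx : 0 < μ x) : 0 < μ y := by
  induction hxy with
  | refl => exact hx
  | tail _ hyz hy =>
    rw [h]
    exact (ENNReal.mul_pos hy.ne' hyz.ne').trans_le (ENNReal.le_tsum _)

/-- Stationarity of `μ` and `ν` gives `μ - ν ≤ (μ - ν) T`, and no inequality can be strict because
`T` does not increase the total mass. -/
lemma tsub (hT : ∀ x, ∑' y, T x y ≤ 1) (hμ : IsStationary T μ) (hν : IsStationary T ν)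
    (hμ_fin : ∑' x, μ x ≠ ∞) : IsStationary T (μ - ν) := by
  have hle : μ - ν ≤ fun y => ∑' x, (μ - ν) x * T x y := by
    intro y
    rw [Pi.sub_apply, tsub_le_iff_right, hμ, hν, ← ENNReal.tsum_add]
    refine ENNReal.tsum_le_tsum fun x => ?_
    rw [← add_mul]
    exact mul_le_mul_left le_tsub_add _
  have hmass : ∑' y, ∑' x, (μ - ν) x * T x y ≤ ∑' x, (μ - ν) x := by
    rw [ENNReal.tsum_comm]
    refine ENNReal.tsum_le_tsum fun x => ?_
    rw [ENNReal.tsum_mul_left]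
    exact mul_le_of_le_one_right' (hT x)
  have hfin : ∑' x, (μ - ν) x ≠ ∞ :=
    ne_top_of_le_ne_top hμ_fin (ENNReal.tsum_le_tsum fun _ => tsub_le_self)
  exact congrFun (eq_of_le_of_tsum_le hle hfin hmass)

lemma lt_of_not_le (hT : ∀ x, ∑' y, T x y ≤ 1) (hμ : IsStationary T μ) (hν : IsStationary T ν)
    (hμ_fin : ∑' x, μ x ≠ ∞) {b : α}
    (hb : ∀ x, Relation.ReflTransGen (fun x y => 0 < T x y) x b) (h : ¬ μ ≤ ν) : ν b < μ b := by
  obtain ⟨x, hx⟩ := not_forall.1 h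
  exact tsub_pos_iff_lt.1 ((tsub hT hμ hν hμ_fin).pos_of_reaches (hb x)
    (tsub_pos_iff_lt.2 (not_le.1 hx)))

lemma eq_of_tsum_eq (hT : ∀ x, ∑' y, T x y ≤ 1) (hμ : IsStationary T μ) (hν : IsStationary T ν)
    (hμ_fin : ∑' x, μ x ≠ ∞) (hmass : ∑' x, μ x = ∑' x, ν x) {b : α}
    (hb : ∀ x, Relation.ReflTransGen (fun x y => 0 < T x y) x b) : μ = ν := by
  have hν_fin : ∑' x, ν x ≠ ∞ := hmass ▸ hμ_fin
  by_contra hne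
  refine lt_asymm (lt_of_not_le hT hμ hν hμ_fin hb fun h => hne ?_)
    (lt_of_not_le hT hν hμ hν_fin hb fun h => hne ?_)
  · exact eq_of_le_of_tsum_le h hμ_fin hmass.ge
  · exact (eq_of_le_of_tsum_le h hν_fin hmass.le).symm

end IsStationary

end StationaryLaws

namespace System

section Uniqueness

variable (M : System N K)

lemma sum_tsum_visitIn_le_one (i : Fin N) (m : ℕ) (x : State K) (g : Fin (K i) → ℕ) :
    ∑ n ∈ Finset.range m, ∑' y, M.visitIn i n x g y ≤ 1 := by
  induction m generalizing x g with
  | zero => simp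
  | succ m ih =>
    rw [Finset.sum_range_succ']
    rcases eq_or_ne g 0 with rfl | hg
    · simp [visitIn]
    obtain ⟨k, hk, hlt⟩ := exists_pos_forall_lt_eq_zero hg
    have hzero : ∑' y, M.visitIn i 0 x g y = 0 := by simp [visitIn, hg]
    simp only [hzero, add_zero, M.visitIn_succ hk hlt]
    calc
      _ = ∑' a, M.arrivals (M.service i k) a * ∑ n ∈ Finset.range m, ∑' y,
            M.visitIn i n (depart x i k + a) (M.entitled i g k (depart x i k + a)) y := by
          simp only [Finset.mul_sum]
          rw [Summable.tsum_finsetSum fun _ _ => ENNReal.summable]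
          refine Finset.sum_congr rfl fun n _ => ?_
          rw [ENNReal.tsum_comm]
          simp only [ENNReal.tsum_mul_left]
      _ ≤ ∑' a, M.arrivals (M.service i k) a * 1 :=
          ENNReal.tsum_le_tsum fun a => mul_le_mul_right (ih _ _) _
      _ = 1 := by simp [tsum_arrivals]

lemma tsum_visit_le_one (i : Fin N) (x : State K) : ∑' y, M.visit i x y ≤ 1 := by
  simp only [visit]
  rw [ENNReal.tsum_comm, ENNReal.tsum_eq_iSup_nat]
  exact iSup_le fun m => M.sum_tsum_visitIn_le_one i m x (x i)

lemma tsum_switch (i : Fin N) (x : State K) : ∑' y, M.switch i x y = 1 := by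
  simp only [switch_eq]
  rw [ENNReal.tsum_comm]
  simp [tsum_arrivals]

lemma tsum_step_le_one (i : Fin N) (x : State K) : ∑' y, M.step i x y ≤ 1 := by
  simp only [step]
  rw [ENNReal.tsum_comm]
  simpa [ENNReal.tsum_mul_left, tsum_switch] using M.tsum_visit_le_one i x

variable {M} in
lemma exists_continueVisit_pos {i : Fin N} {r s : State K}
    (h : (M.discipline i).IsSplit i r s) : ∃ n, 0 < M.continueVisit i n r s r := by
  induction s using State.induction with
  | zero => exact ⟨0, by simp [continueVisit_zero h]⟩
  | add_customer s j k ih =>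
    obtain rfl : j = i := by
      by_contra hj
      exact add_customer_apply_ne_zero s j k (h.apply_of_ne j hj)
    have h := h.of_add_customer
    obtain ⟨n, hn⟩ := ih h
    refine ⟨n + 1, ?_⟩
    rw [continueVisit_succ h]
    refine lt_of_lt_of_le ?_ (ENNReal.le_tsum 0)
    simpa using ⟨M.arrivals_zero_pos _, hn⟩

/-- With positive probability nobody arrives until the next visit beginning. -/
lemma step_update_zero_pos (i : Fin N) (x : State K) :
    0 < M.step i x (Function.update x i 0) := by
  have hvisit : 0 < M.visit i x (Function.update x i 0) := by
    obtain ⟨n, hn⟩ := exists_continueVisit_pos ((M.discipline i).isSplit_update_single i x)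
    rw [visit_eq_tsum_continueVisit]
    exact hn.trans_le (ENNReal.le_tsum n)
  have hswitch : 0 < M.switch i (Function.update x i 0) (Function.update x i 0) := by
    rw [switch_eq]
    refine lt_of_lt_of_le ?_ (ENNReal.le_tsum 0)
    simpa using M.arrivals_zero_pos _
  exact (ENNReal.mul_pos hvisit.ne' hswitch.ne').trans_le (ENNReal.le_tsum _)

variable [NeZero N]

/-- The transition probabilities of the pair of the queue whose visit begins and the state at that
moment. A steady state at visit beginnings is stationary for this chain, with total mass `N`. -/
noncomputable def cycleStep (c c' : Fin N × State K) : ℝ≥0∞ :=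
  if c'.1 = c.1 + 1 then M.step c.1 c.2 c'.2 else 0

lemma tsum_cycleStep_le_one (c : Fin N × State K) : ∑' c', M.cycleStep c c' ≤ 1 := by
  rw [ENNReal.tsum_prod', tsum_eq_single (c.1 + 1) fun i hi => by simp [cycleStep, hi]]
  simpa [cycleStep] using M.tsum_step_le_one c.1 c.2

open Fin.CommRing in
lemma reaches_zero (c : Fin N × State K) :
    Relation.ReflTransGen (fun c c' => 0 < M.cycleStep c c') c (0, 0) := by
  obtain ⟨i, x⟩ := c
  have hempty (n : ℕ) : ∃ x', Relation.ReflTransGen (fun c c' => 0 < M.cycleStep c c')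
      (i, x) (i + n, x') ∧ ∀ m < n, x' (i + m) = 0 := by
    induction n with
    | zero => exact ⟨x, by simp [Relation.ReflTransGen.refl], by simp⟩
    | succ n ih =>
      obtain ⟨x', hreach, hx'⟩ := ih
      refine ⟨Function.update x' (i + n) 0, hreach.tail ?_, fun m hm => ?_⟩
      · simpa [cycleStep, add_assoc] using M.step_update_zero_pos (i + n) x'
      · by_cases h : i + (m : Fin N) = i + n
        · rw [h, Function.update_self]
        · rw [Function.update_of_ne h]
          refine hx' m (lt_of_le_of_ne (Nat.lt_succ_iff.1 hm) ?_)
          rintro rfl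
          exact h rfl
  obtain ⟨x', hreach, hx'⟩ := hempty (N + (-i).val)
  obtain rfl : x' = 0 := by
    ext1 j
    have hj := hx' (j - i).val ((j - i).isLt.trans_le (Nat.le_add_right N _))
    rwa [Fin.cast_val_eq_self, add_sub_cancel] at hj
  simpa using hreach

variable {M} {P Q : Fin N → PMF (State K)}

lemma IsSteadyState.isStationary (hP : M.IsSteadyState P) :
    IsStationary M.cycleStep fun c => P c.1 c.2 := by
  rintro ⟨j, y⟩
  obtain ⟨i, rfl⟩ : ∃ i, j = i + 1 := ⟨j - 1, (sub_add_cancel j 1).symm⟩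
  rw [ENNReal.tsum_prod', tsum_eq_single i fun i' hi' => by simp [cycleStep, hi'.symm]]
  simp [cycleStep, hP i y]

lemma IsSteadyState.unique (hP : M.IsSteadyState P) (hQ : M.IsSteadyState Q) : P = Q := by
  have hmass (R : Fin N → PMF (State K)) : ∑' c : Fin N × State K, R c.1 c.2 = N := by
    simp [ENNReal.tsum_prod', PMF.tsum_coe]
  have h := hP.isStationary.eq_of_tsum_eq M.tsum_cycleStep_le_one hQ.isStationary
    (by simp [hmass]) (by simp only [hmass]) M.reaches_zero
  ext i x
  rw [congrFun h (i, x)]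

end Uniqueness

end System
end Polling

theorem lemma1_general {N : ℕ} [NeZero N] {K : Fin N → ℕ} (M : Polling.System N K)
    (P : Fin N → PMF (Polling.State (fun _ : Fin N => 1)))
    (hP : M.withoutPriorities.IsSteadyState P) :
    (∃! P' : Fin N → PMF (Polling.State K), M.IsSteadyState P') ∧
    ∀ P' : Fin N → PMF (Polling.State K), M.IsSteadyState P' →
      ∀ (i : Fin N) (z : (j : Fin N) → Fin (K j) → ℂ), (∀ j k, ‖z j k‖ ≤ 1) →
        Polling.genFun (P' i) z =
          Polling.genFun (P i) (fun j _ =>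
            (1 / ((M.totalRate j : ℝ) : ℂ)) * ∑ k, ((M.rate j k : ℝ) : ℂ) * z j k) := by
  have h := M.isSteadyState_labelled hP
  refine ⟨⟨_, h, fun P' hP' => hP'.unique h⟩, fun P' hP' i z hz => ?_⟩
  rw [hP'.unique h, Polling.genFun_labelled M.sum_levelProb (P i) hz]
  simp only [M.sum_levelProb_smul]

theorem lemma1 {N : ℕ} [NeZero N] {K : Fin N → ℕ} (M : Polling.System N K) (hρ : M.load < 1)
    (P : Fin N → PMF (Polling.State (fun _ : Fin N => 1)))
    (hP : M.withoutPriorities.IsSteadyState P) :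
    (∃! P' : Fin N → PMF (Polling.State K), M.IsSteadyState P') ∧
    ∀ P' : Fin N → PMF (Polling.State K), M.IsSteadyState P' →
      ∀ (i : Fin N) (z : (j : Fin N) → Fin (K j) → ℂ), (∀ j k, ‖z j k‖ ≤ 1) →
        Polling.genFun (P' i) z =
          Polling.genFun (P i) (fun j _ =>
            (1 / ((M.totalRate j : ℝ) : ℂ)) * ∑ k, ((M.rate j k : ℝ) : ℂ) * z j k) :=
  lemma1_general M P hP
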